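/- **Fixed-precision transformers.** For integers $p \ge 1$ and $s \ge 0$ let $\mathbb F=\mathbb F_{p,s}$ be the set of numbers $m\cdot 2^{-s}$ with $m\in\mathbb Z$ and $-2^{p-1}\le m<2^{p-1}$. For $x\in\mathbb R$ let $\mathrm{round}(x)$ be the greatest element of $\mathbb F$ that is at most $x$ (and the least element of $\mathbb F$ if $x$ is below all of $\mathbb F$). A *(future-masked) fixed-precision transformer* of depth $k$ over an alphabet $\Gamma$, without positional encoding, is given by $p\ge 1$, $s\ge 0$, $d\ge 0$ and arbitrary functions $E\colon\Gamma\to\mathbb F^d$; $W_Q^{(\ell)},W_K^{(\ell)},W_V^{(\ell)},f^{(\ell)}\colon\mathbb F^d\to\mathbb F^d$ for $\ell=1,\dots,k$; and $W_{\mathrm{out}}\colon\mathbb F^d\to\mathbb F$; none of these depends on the length of the input. On a nonempty string $w=w_1\cdots w_n$ over $\Gamma$ it computes $\mathbf h_i^{(0)}=E(w_i)$ and, for $\ell=1,\dots,k$ and $1\le i\le n$, with $\mathbf q_i=W_Q^{(\ell)}(\mathbf h_i^{(\ell-1)})$, $\mathbf k_i=W_K^{(\ell)}(\mathbf h_i^{(\ell-1)})$,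 $\mathbf v_i=W_V^{(\ell)}(\mathbf h_i^{(\ell-1)})$, $$\mathbf c_i=\mathrm{round}\left(\frac{\sum_{j=1}^{i}\mathrm{round}\big(e^{\mathbf q_i\cdot\mathbf k_j}\,\mathbf v_j\big)}{\sum_{j=1}^{i}\mathrm{round}\big(e^{\mathbf q_i\cdot\mathbf k_j}\big)}\right),\qquad \mathbf h_i^{(\ell)}=f^{(\ell)}\big(\mathrm{round}(\mathbf c_i+\mathbf h_i^{(\ell-1)})\big),$$ where vectors are rounded componentwise and $\mathbf c_i=\mathrm{round}\big(\tfrac1i\sum_{j\le i}\mathbf v_j\big)$ if the denominator is $0$. It *accepts* $w$ if $W_{\mathrm{out}}(\mathbf h_n^{(k)})>0$; the empty string is not accepted. **Recognition.** Let $\Sigma=\{a,b\}$ and let $L\subseteq\Sigma^*$. A transformer over $\Sigma\cup\{\texttt{<BOS>}\}$ recognizes $L$ *with beginning-of-string symbol* if for all $w\in\Sigma^*$ it accepts $\texttt{<BOS>}\cdot w$ if and only if $w\in L$. A transformer over $\Sigma$ recognizes $L$ *without beginning-of-string symbol* if for all $w\in\Sigma^*$ it accepts $w$ if and only if $w\in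 L$. **Theorem.** For $k\ge 0$ let $L_k=(a^+b^+)^{k/2}$ if $k$ is even and $L_k=(a^+b^+)^{(k-1)/2}a^+$ if $k$ is odd. Then for every $k\ge 0$, some fixed-precision transformer of depth $k+1$ recognizes $L_{k+1}$, but no fixed-precision transformer of depth $k$ (whatever its $p$, $s$, $d$ and parameter functions) recognizes $L_{k+1}$. Consequently the class of languages over $\{a,b\}$ recognized by fixed-precision transformers of depth $k$ is strictly contained in the class of those recognized by fixed-precision transformers of depth $k+1$. Both assertions hold with and without beginning-of-string symbol. -/

import Mathlib

namespace FPTransformer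

/-- The set of fixed-precision numbers with `p` total bits (`1 ≤ p`) and `s` fractional bits:
the numbers `m * 2 ^ (-s)` with `m` an integer, `-2 ^ (p - 1) ≤ m < 2 ^ (p - 1)`. -/
def fixedPrec (p s : ℕ) : Set ℝ :=
  {x | ∃ m : ℤ, -2 ^ (p - 1) ≤ m ∧ m < 2 ^ (p - 1) ∧ x = (m : ℝ) / 2 ^ s}

/-- Rounding down to the greatest fixed-precision number below `x`; a number below all
fixed-precision numbers is sent to the least one. -/
noncomputable def round (p s : ℕ) (x : ℝ) : fixedPrec p s :=
  ⟨((max (-2 ^ (p - 1)) (min ⌊x * 2 ^ s⌋ (2 ^ (p - 1) - 1)) : ℤ) : ℝ) / 2 ^ s,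
    max (-2 ^ (p - 1)) (min ⌊x * 2 ^ s⌋ (2 ^ (p - 1) - 1)), le_max_left _ _, by
      have h : (0 : ℤ) < 2 ^ (p - 1) := by positivity
      exact max_lt (by linarith) (lt_of_le_of_lt (min_le_right _ _) (by linarith)), rfl⟩

/-- If some fixed-precision number is at most `x`, then `round p s x` is the greatest such. -/
theorem round_isGreatest (p s : ℕ) (x : ℝ) (hx : ∃ y ∈ fixedPrec p s, y ≤ x) :
    IsGreatest {y | y ∈ fixedPrec p s ∧ y ≤ x} (round p s x : ℝ) := by
  have h2 : (0 : ℝ) < 2 ^ s := by positivity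
  obtain ⟨y, ⟨m, hm1, hm2, rfl⟩, hy⟩ := hx
  have hm : m ≤ ⌊x * 2 ^ s⌋ := Int.le_floor.2 ((div_le_iff₀ h2).1 hy)
  refine ⟨⟨(round p s x).2, ?_⟩, ?_⟩
  · show (_ : ℝ) / 2 ^ s ≤ x
    rw [div_le_iff₀ h2, ← Int.le_floor]
    exact max_le (hm1.trans hm) (min_le_left _ _)
  · rintro z ⟨⟨n, hn1, hn2, rfl⟩, hz⟩
    have hn : n ≤ ⌊x * 2 ^ s⌋ := Int.le_floor.2 ((div_le_iff₀ h2).1 hz)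
    show (n : ℝ) / 2 ^ s ≤ _ / 2 ^ s
    refine div_le_div_of_nonneg_right ?_ h2.le
    exact Int.cast_le.2 ((le_min hn (Int.le_sub_one_of_lt hn2)).trans (le_max_right _ _))

/-- Vectors of `d` fixed-precision numbers. -/
abbrev Vec (p s d : ℕ) : Type := Fin d → fixedPrec p s

/-- The parameters of one layer: the query, key and value maps and the feed-forward map. -/
structure Layer (p s d : ℕ) where
  WQ : Vec p s d → Vec p s d
  WK : Vec p s d → Vec p s d
  WV : Vec p s d → Vec p s d
  f : Vec p s d → Vec p s d

namespace Layer

variable {p s d n : ℕ}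

/-- The attention logit: the (unrounded) dot product of query `i` and key `j`. -/
noncomputable def logit (L : Layer p s d) (h : Fin n → Vec p s d) (i j : Fin n) : ℝ :=
  ∑ c, (L.WQ (h i) c : ℝ) * (L.WK (h j) c : ℝ)

/-- The numerator of coordinate `c` of the attention output at position `i`; the sum runs over
the positions up to `i` (future masking) and is not rounded. -/
noncomputable def numer (L : Layer p s d) (h : Fin n → Vec p s d) (i : Fin n) (c : Fin d) : ℝ :=
  ∑ j ∈ Finset.Iic i, (round p s (Real.exp (L.logit h i j) * (L.WV (h j) c : ℝ)) : ℝ)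

/-- The denominator of the attention output at position `i`. -/
noncomputable def denom (L : Layer p s d) (h : Fin n → Vec p s d) (i : Fin n) : ℝ :=
  ∑ j ∈ Finset.Iic i, (round p s (Real.exp (L.logit h i j)) : ℝ)

/-- The attention output; if the denominator is `0`, it is the average of the values. -/
noncomputable def attention (L : Layer p s d) (h : Fin n → Vec p s d) (i : Fin n) :
    Vec p s d := fun c =>
  if L.denom h i = 0 then
    round p s ((∑ j ∈ Finset.Iic i, (L.WV (h j) c : ℝ)) / ((Finset.Iic i).card : ℝ))
  else
    round p s (L.numer h i c / L.denom h i)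

/-- One layer: attention, residual connection, feed-forward map. -/
noncomputable def apply (L : Layer p s d) (h : Fin n → Vec p s d) : Fin n → Vec p s d :=
  fun i => L.f (fun c => round p s ((L.attention h i c : ℝ) + (h i c : ℝ)))

end Layer

end FPTransformer

/-- A future-masked fixed-precision transformer over the alphabet `σ` without position encoding,
with `p` total bits, `s` fractional bits and dimension `d`. Its parameters do not depend on
the length of the input. -/
structure FPTransformer (σ : Type) (p s d : ℕ) where
  embed : σ → FPTransformer.Vec p s d
  layers : List (FPTransformer.Layer p s d)
  Wout : FPTransformer.Vec p s d → FPTransformer.fixedPrec p s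

namespace FPTransformer

variable {σ : Type} {p s d : ℕ}

/-- The depth is the number of layers. -/
def depth (T : FPTransformer σ p s d) : ℕ := T.layers.length

/-- The activations after the last layer. -/
noncomputable def hidden (T : FPTransformer σ p s d) (w : List σ) :
    Fin w.length → Vec p s d :=
  T.layers.foldl (fun h L => L.apply h) (fun i => T.embed (w.get i))

/-- The output on a nonempty string, computed from the activation at its last position. -/
noncomputable def output (T : FPTransformer σ p s d) (w : List σ) (hw : w ≠ []) :
    fixedPrec p s :=
  T.Wout (T.hidden w ⟨w.length - 1, Nat.sub_lt (List.length_pos_iff.2 hw) Nat.one_pos⟩)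

/-- `T` accepts `w` if its output is positive. There is no last position in the empty string,
which is not accepted. -/
def Accepts (T : FPTransformer σ p s d) (w : List σ) : Prop :=
  ∃ hw : w ≠ [], 0 < (T.output w hw : ℝ)

/-- `T` recognizes `L` when run directly on the strings over the alphabet of `L`. -/
def Recognizes (T : FPTransformer σ p s d) (L : Language σ) : Prop :=
  ∀ w : List σ, T.Accepts w ↔ w ∈ L

/-- `T` recognizes `L` when a beginning-of-string symbol, here `none`, is prepended
to every input. -/
def RecognizesBOS (T : FPTransformer (Option σ) p s d) (L : Language σ) : Prop :=
  ∀ w : List σ, T.Accepts (none :: w.map some) ↔ w ∈ L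

/-- The languages recognized by depth-`k` fixed-precision transformers, without
beginning-of-string symbol. -/
def recognizable (σ : Type) (k : ℕ) : Set (Language σ) :=
  {L | ∃ (p s d : ℕ) (T : FPTransformer σ p s d), 1 ≤ p ∧ T.depth = k ∧ T.Recognizes L}

/-- The languages recognized by depth-`k` fixed-precision transformers, with
beginning-of-string symbol. -/
def recognizableBOS (σ : Type) (k : ℕ) : Set (Language σ) :=
  {L | ∃ (p s d : ℕ) (T : FPTransformer (Option σ) p s d),
    1 ≤ p ∧ T.depth = k ∧ T.RecognizesBOS L}

/-- The alphabet `{a, b}`. -/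
inductive Letter : Type
  | a
  | b

/-- The language `x⁺`. -/
def plus (x : Letter) : Language Letter := {[x]} * KStar.kstar {[x]}

/-- `L_k`: the strings that consist of `k` alternating blocks of `a`'s and `b`'s, starting with
`a`. -/
def altPlus (k : ℕ) : Language Letter :=
  if Even k then (plus Letter.a * plus Letter.b) ^ (k / 2)
  else (plus Letter.a * plus Letter.b) ^ ((k - 1) / 2) * plus Letter.a

end FPTransformer

namespace FPTransformer

/-! ### The languages `altPlus k` -/

/-! Lower bound. A rounded quotient N/D is determined by the answers to finitely many questions m ≤
2^s N/D, that is 0 ≤ 2^s N - mD, and both N and D are sums over the positions seen. So a layer's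
output at a position depends only on its own activation and on the signs of finitely many such sums
(`Layer.next_eq_of_thresholds`). If, after some prefix, the incoming activations depend only on the
letter, each sum is affine in the numbers of a's and b's read since. Finitely many affine
inequalities are all constant on some subsquare of any large enough square of counts
(`exists_subsquare`), and its corner can be reached by lengthening the current block and adding one
new block. From there on, within the square, the layer's output again depends only on the letter.
Hence k layers are blinded by a prefix with k + 1 blocks (`exists_uniform_prefix`), after which
acceptance depends only on the last letter; but repeating the last letter preserves membership,
while changing letter and changing back destroys it.

Upper bound. Each position stores its letter and a capped count of the blocks so far. With uniform
attention and values -1, rounding down detects whether some marked position is visible, whatever the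
length. Each layer uses this to raise the cap by one (`runLayers_countLayer`). -/

instance : DecidableEq Letter
  | .a, .a => isTrue rfl
  | .b, .b => isTrue rfl
  | .a, .b => isFalse Letter.noConfusion
  | .b, .a => isFalse Letter.noConfusion

/-- The letter of the block with index `k`, counted from `0`, of a string in some `altPlus`. -/
def blockLetter (k : ℕ) : Letter := if Even k then .a else .b

theorem blockLetter_succ_ne (k : ℕ) : blockLetter (k + 1) ≠ blockLetter k := by
  unfold blockLetter
  by_cases h : Even k <;> simp [h, Nat.even_add_one]

theorem eq_of_ne_of_ne {x y z : Letter} (h : x ≠ y) (h' : z ≠ y) : x = z := by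
  cases x <;> cases y <;> cases z <;> simp_all

theorem altPlus_zero : altPlus 0 = 1 := by simp [altPlus]

theorem altPlus_succ (k : ℕ) : altPlus (k + 1) = altPlus k * plus (blockLetter k) := by
  unfold altPlus blockLetter
  by_cases h : Even k
  · simp [h, Nat.even_add_one]
  · obtain ⟨m, rfl⟩ := Nat.not_even_iff_odd.1 h
    have h2 : (2 * m + 1 + 1) / 2 = m + 1 := by omega
    simp [h, Nat.even_add_one, h2, pow_succ, mul_assoc]

theorem nil_notMem_altPlus_succ (k : ℕ) : [] ∉ altPlus (k + 1) := by
  rw [altPlus_succ, Language.mem_mul]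
  rintro ⟨u, -, v, hv, huv⟩
  obtain ⟨x, hx, y, -, rfl⟩ := Language.mem_mul.1 hv
  obtain rfl : x = [blockLetter k] := hx
  simp at huv

theorem mem_plus_iff (x : Letter) (w : List Letter) :
    w ∈ plus x ↔ ∃ n, w = List.replicate (n + 1) x := by
  have hpow : ∀ n, ({[x]} : Language Letter) ^ n = {List.replicate n x} := by
    intro n
    induction n with
    | zero => rfl
    | succ n ih =>
      rw [pow_succ', ih]
      ext v
      rw [Language.mem_mul]
      constructor
      · rintro ⟨_, rfl, _, rfl, rfl⟩
        rfl
      · rintro rfl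
        exact ⟨_, rfl, _, rfl, rfl⟩
  rw [plus, Language.mem_mul]
  constructor
  · rintro ⟨_, rfl, v, hv, rfl⟩
    rw [Language.kstar_eq_iSup_pow, Language.mem_iSup] at hv
    obtain ⟨n, hn⟩ := hv
    rw [hpow] at hn
    obtain rfl : v = _ := hn
    exact ⟨n, rfl⟩
  · rintro ⟨n, rfl⟩
    refine ⟨[x], rfl, List.replicate n x, ?_, rfl⟩
    rw [Language.kstar_eq_iSup_pow, Language.mem_iSup]
    exact ⟨n, by rw [hpow]; rfl⟩

/-- The last letter either lengthens the last block or is the whole of it. -/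
theorem concat_mem_altPlus_succ (k : ℕ) (u : List Letter) (z : Letter) :
    u ++ [z] ∈ altPlus (k + 1) ↔ z = blockLetter k ∧ (u ∈ altPlus (k + 1) ∨ u ∈ altPlus k) := by
  simp only [altPlus_succ, Language.mem_mul, mem_plus_iff]
  constructor
  · rintro ⟨v, hv, _, ⟨n, rfl⟩, h⟩
    rw [List.replicate_succ', ← List.append_assoc] at h
    obtain ⟨h1, h2⟩ := List.append_inj' h rfl
    refine ⟨(List.singleton_inj.1 h2).symm, ?_⟩
    cases n with
    | zero => right; simpa [← h1] using hv
    | succ n => exact .inl ⟨v, hv, _, ⟨n, rfl⟩, h1⟩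
  · rintro ⟨rfl, ⟨v, hv, _, ⟨n, rfl⟩, rfl⟩ | h⟩
    · exact ⟨v, hv, _, ⟨n + 1, rfl⟩, by rw [List.replicate_succ' (n := n + 1)]; simp⟩
    · exact ⟨u, h, _, ⟨0, rfl⟩, rfl⟩

/-- The number of blocks of equal letters. -/
def numBlocks (w : List Letter) : ℕ :=
  (w.foldl (fun c z => (some z, if c.1 = some z then c.2 else c.2 + 1))
    ((none, 0) : Option Letter × ℕ)).2

@[simp] theorem numBlocks_nil : numBlocks [] = 0 := rfl

theorem numBlocks_concat (w : List Letter) (z : Letter) :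
    numBlocks (w ++ [z]) = if w.getLast? = some z then numBlocks w else numBlocks w + 1 := by
  have h : ∀ v : List Letter, (v.foldl (fun c z => (some z, if c.1 = some z then c.2 else c.2 + 1))
      ((none, 0) : Option Letter × ℕ)).1 = v.getLast? := by
    intro v
    induction v using List.reverseRecOn with
    | nil => rfl
    | append_singleton v z _ => simp
  simp [numBlocks, List.foldl_append, h]

theorem numBlocks_pos {w : List Letter} (h : w ≠ []) : 0 < numBlocks w := by
  induction w using List.reverseRecOn with
  | nil => exact absurd rfl h
  | append_singleton w z ih =>
    rw [numBlocks_concat]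
    split_ifs with hz
    · exact ih (by rintro rfl; simp at hz)
    · omega

theorem mem_altPlus_succ_iff (k : ℕ) (w : List Letter) :
    w ∈ altPlus (k + 1) ↔ numBlocks w = k + 1 ∧ w.getLast? = some (blockLetter k) := by
  induction w using List.reverseRecOn generalizing k with
  | nil => simp [nil_notMem_altPlus_succ]
  | append_singleton w z ih =>
    rw [concat_mem_altPlus_succ, numBlocks_concat, List.getLast?_concat, Option.some_inj, ih,
      and_comm]
    refine and_congr_left ?_
    rintro rfl
    -- With two letters, differing from the next block's letter means ending in the right one. The
    -- negative form also covers `k = 0`, where there is no last letter.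
    have hk : w ∈ altPlus k ↔ numBlocks w = k ∧ w.getLast? ≠ some (blockLetter k) := by
      cases k with
      | zero =>
        rw [altPlus_zero, Language.mem_one]
        constructor
        · rintro rfl; simp
        · rintro ⟨h, -⟩
          by_contra h'
          exact (numBlocks_pos h').ne' h
      | succ j =>
        rw [ih]
        refine and_congr_right fun h => ?_
        obtain ⟨y, hy⟩ : ∃ y, w.getLast? = some y := by
          rcases w.eq_nil_or_concat with rfl | ⟨v, y, rfl⟩
          · simp at h
          · exact ⟨y, by simp⟩
        rw [hy, Option.some_inj, Ne, Option.some_inj]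
        constructor
        · rintro rfl; exact (blockLetter_succ_ne j).symm
        · intro h'
          exact eq_of_ne_of_ne h' (blockLetter_succ_ne j).symm
    rw [hk]
    split_ifs with h <;> simp [h]

/-! ### Lists of activations -/

variable {σ : Type} {p s d : ℕ}

/-- The attention output at a position with activation `h`, where `hs` lists the activations up
to and including this position. -/
noncomputable def Layer.attend (L : Layer p s d) (hs : List (Vec p s d)) (h : Vec p s d) :
    Vec p s d := fun c =>
  if (hs.map fun g => (round p s (Real.exp (∑ c, (L.WQ h c : ℝ) * (L.WK g c : ℝ))) : ℝ)).sum = 0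
  then round p s ((hs.map fun g => (L.WV g c : ℝ)).sum / hs.length)
  else round p s
    ((hs.map fun g => (round p s (Real.exp (∑ c, (L.WQ h c : ℝ) * (L.WK g c : ℝ)) *
      (L.WV g c : ℝ)) : ℝ)).sum /
    (hs.map fun g => (round p s (Real.exp (∑ c, (L.WQ h c : ℝ) * (L.WK g c : ℝ))) : ℝ)).sum)

/-- The new activation at a position with activation `h`, where `hs` lists the activations up
to and including this position. -/
noncomputable def Layer.next (L : Layer p s d) (hs : List (Vec p s d)) (h : Vec p s d) :
    Vec p s d :=
  L.f fun c => round p s ((L.attend hs h c : ℝ) + (h c : ℝ))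

/-- A layer as a map on lists of activations. -/
noncomputable def Layer.scan (L : Layer p s d) (hs : List (Vec p s d)) : List (Vec p s d) :=
  hs.mapIdx fun i h => L.next (hs.take (i + 1)) h

/-- Future masking: earlier positions do not see the new one. The inductions on strings below rest
on this. -/
theorem Layer.scan_concat (L : Layer p s d) (hs : List (Vec p s d)) (h : Vec p s d) :
    L.scan (hs ++ [h]) = L.scan hs ++ [L.next (hs ++ [h]) h] := by
  unfold scan
  rw [List.mapIdx_concat, List.take_of_length_le (by simp)]
  congr 1
  refine List.ext_getElem (by simp) fun i h1 h2 => ?_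
  simp only [List.length_mapIdx] at h2
  simp only [List.getElem_mapIdx]
  rw [List.take_append_of_le_length (by omega)]

theorem sum_Iic_eq_sum_take {α : Type} {n : ℕ} (h : Fin n → α) (F : α → ℝ) (i : Fin n) :
    ∑ j ∈ Finset.Iic i, F (h j) = (((List.ofFn h).take (i + 1)).map F).sum := by
  obtain ⟨i, hi⟩ := i
  induction i with
  | zero =>
    have : (Finset.Iic (⟨0, hi⟩ : Fin n)) = {⟨0, hi⟩} := by
      ext j; simp [Fin.le_def, Fin.ext_iff]
    rw [this, Finset.sum_singleton, List.take_succ_eq_append_getElem (by simpa using hi)]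
    simp
  | succ i ih =>
    have : (Finset.Iic (⟨i + 1, hi⟩ : Fin n)) =
        insert ⟨i + 1, hi⟩ (Finset.Iic ⟨i, by omega⟩) := by
      ext j; simp [Fin.le_def, Fin.ext_iff]; omega
    rw [this, Finset.sum_insert (by simp [Fin.le_def]), ih,
      List.take_succ_eq_append_getElem (i := i + 1) (by simpa using hi), List.map_append,
      List.sum_append, add_comm]
    simp

theorem Layer.apply_eq_next (L : Layer p s d) {n : ℕ} (h : Fin n → Vec p s d) (i : Fin n) :
    L.apply h i = L.next ((List.ofFn h).take (i + 1)) (h i) := by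
  have hn : ((List.ofFn h).take (i + 1)).length = (Finset.Iic i).card := by
    simp
  unfold apply next
  congr 1
  funext c
  congr 3
  simp only [attention, attend, denom, numer, logit, hn,
    sum_Iic_eq_sum_take h (fun g => (L.WV g c : ℝ)),
    sum_Iic_eq_sum_take h
      (fun g => (round p s (Real.exp (∑ c, (L.WQ (h i) c : ℝ) * (L.WK g c : ℝ))) : ℝ)),
    sum_Iic_eq_sum_take h
      (fun g => (round p s (Real.exp (∑ c, (L.WQ (h i) c : ℝ) * (L.WK g c : ℝ)) *
        (L.WV g c : ℝ)) : ℝ))]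

theorem Layer.ofFn_apply (L : Layer p s d) {n : ℕ} (h : Fin n → Vec p s d) :
    List.ofFn (L.apply h) = L.scan (List.ofFn h) := by
  refine List.ext_getElem (by simp [scan]) fun i h1 h2 => ?_
  simp [scan, apply_eq_next]

/-- The result of running a list of layers on a list of activations. -/
noncomputable def runLayers (Ls : List (Layer p s d)) (hs : List (Vec p s d)) :
    List (Vec p s d) :=
  Ls.foldl (fun hs L => L.scan hs) hs

theorem runLayers_concat (Ls : List (Layer p s d)) (L : Layer p s d) (hs : List (Vec p s d)) :
    runLayers (Ls ++ [L]) hs = L.scan (runLayers Ls hs) := by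
  simp [runLayers]

theorem ofFn_foldl_apply (Ls : List (Layer p s d)) {n : ℕ} (h : Fin n → Vec p s d) :
    List.ofFn (Ls.foldl (fun h L => L.apply h) h) = runLayers Ls (List.ofFn h) := by
  induction Ls using List.reverseRecOn with
  | nil => rfl
  | append_singleton Ls L ih =>
    rw [runLayers_concat, List.foldl_append, ← ih]
    exact L.ofFn_apply _

theorem accepts_iff (T : FPTransformer σ p s d) (w : List σ) :
    T.Accepts w ↔
      ∃ h, (runLayers T.layers (w.map T.embed)).getLast? = some h ∧ 0 < (T.Wout h : ℝ) := by
  have key : List.ofFn (T.hidden w) = runLayers T.layers (w.map T.embed) := by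
    rw [hidden, ofFn_foldl_apply]
    congr 1
    refine List.ext_getElem (by simp) fun i h1 h2 => by simp
  rw [← key, Accepts]
  have hlast : ∀ hw : w ≠ [], (List.ofFn (T.hidden w)).getLast? =
      some (T.hidden w ⟨w.length - 1, Nat.sub_lt (List.length_pos_iff.2 hw) Nat.one_pos⟩) := by
    intro hw
    have := List.length_pos_iff.2 hw
    rw [List.getLast?_eq_getElem?, List.getElem?_eq_getElem (by simp; omega)]
    simp
  constructor
  · rintro ⟨hw, h⟩
    exact ⟨_, hlast hw, h⟩
  · rintro ⟨h, hh, h0⟩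
    have hw : w ≠ [] := by rintro rfl; simp at hh
    rw [hlast hw, Option.some_inj] at hh
    exact ⟨hw, by rw [output, hh]; exact h0⟩

/-! ### Rounding -/

theorem round_eq_of_thresholds {x y : ℝ}
    (h : ∀ m ∈ Finset.Ico (-2 ^ (p - 1) : ℤ) (2 ^ (p - 1)),
      ((m : ℝ) ≤ x * 2 ^ s ↔ (m : ℝ) ≤ y * 2 ^ s)) : round p s x = round p s y := by
  have hB : (0 : ℤ) < 2 ^ (p - 1) := by positivity
  simp only [← Int.le_floor, Finset.mem_Ico] at h
  refine Subtype.ext ?_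
  change ((max (-2 ^ (p - 1)) (min ⌊x * 2 ^ s⌋ (2 ^ (p - 1) - 1)) : ℤ) : ℝ) / 2 ^ s =
    ((max (-2 ^ (p - 1)) (min ⌊y * 2 ^ s⌋ (2 ^ (p - 1) - 1)) : ℤ) : ℝ) / 2 ^ s
  generalize ⌊x * 2 ^ s⌋ = X at h
  generalize ⌊y * 2 ^ s⌋ = Y at h
  generalize (2 : ℤ) ^ (p - 1) = B at h hB
  congr 2
  -- The two clamped floors themselves are the thresholds that show each to be at most the other.
  have h1 := h (max (-B) (min X (B - 1))) (by omega)
  have h2 := h (max (-B) (min Y (B - 1))) (by omega)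
  omega

theorem round_coe (x : fixedPrec p s) : round p s (x : ℝ) = x := by
  obtain ⟨x, m, h1, h2, rfl⟩ := x
  unfold round
  apply Subtype.ext
  have h3 : (m : ℝ) / 2 ^ s * 2 ^ s = m := div_mul_cancel₀ _ (by positivity)
  simp only [h3, Int.floor_intCast]
  congr 2
  omega

theorem zero_mem_fixedPrec : (0 : ℝ) ∈ fixedPrec p s := ⟨0, by simp, by positivity, by simp⟩

theorem round_nonneg {x : ℝ} (hx : 0 ≤ x) : 0 ≤ (round p s x : ℝ) :=
  (round_isGreatest p s x ⟨0, zero_mem_fixedPrec, hx⟩).2 ⟨zero_mem_fixedPrec, hx⟩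

theorem round_zero : (round p s 0 : ℝ) = 0 :=
  congrArg Subtype.val (round_coe (⟨0, zero_mem_fixedPrec⟩ : fixedPrec p s))

/-! ### A layer evaluates finitely many linear threshold conditions -/

/-- Indices for the threshold conditions on which the output of a layer depends. -/
abbrev ThresholdIndex (p d : ℕ) : Type :=
  Option (Bool × Fin d × Finset.Ico (-2 ^ (p - 1) : ℤ) (2 ^ (p - 1)))

/-- The contribution of a position with activation `g` to a threshold condition at a position
with activation `h`. -/
noncomputable def Layer.weight (L : Layer p s d) (h : Vec p s d) :
    ThresholdIndex p d → Vec p s d → ℝ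
  | none, g => -(round p s (Real.exp (∑ c, (L.WQ h c : ℝ) * (L.WK g c : ℝ))) : ℝ)
  | some (false, c, m), g => (L.WV g c : ℝ) * 2 ^ s - (m : ℤ)
  | some (true, c, m), g =>
    (round p s (Real.exp (∑ c, (L.WQ h c : ℝ) * (L.WK g c : ℝ)) * (L.WV g c : ℝ)) : ℝ) * 2 ^ s -
      (m : ℤ) * (round p s (Real.exp (∑ c, (L.WQ h c : ℝ) * (L.WK g c : ℝ))) : ℝ)

theorem sum_map_mul_sub {α : Type} (l : List α) (F G : α → ℝ) (t m : ℝ) :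
    (l.map fun g => F g * t - m * G g).sum = (l.map F).sum * t - m * (l.map G).sum := by
  induction l with
  | nil => simp
  | cons x l ih => simp only [List.map_cons, List.sum_cons, ih]; ring

/-- Index `none` decides whether the denominator vanishes: its terms are nonnegative, so minus their
sum is nonnegative only at zero. The other indices compare the plain average (`false`) or the
weighted quotient (`true`) with each representable number, after clearing the positive denominator.
-/
theorem Layer.next_eq_of_thresholds (L : Layer p s d) (h : Vec p s d)
    {hs hs' : List (Vec p s d)} (hne : hs ≠ []) (hne' : hs' ≠ [])
    (H : ∀ i, 0 ≤ (hs.map (L.weight h i)).sum ↔ 0 ≤ (hs'.map (L.weight h i)).sum) :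
    L.next hs h = L.next hs' h := by
  unfold next
  congr 1
  funext c
  congr 3
  have hden : ∀ l : List (Vec p s d), 0 ≤
      (l.map fun g => (round p s (Real.exp (∑ c, (L.WQ h c : ℝ) * (L.WK g c : ℝ))) : ℝ)).sum := by
    intro l
    refine List.sum_nonneg fun x hx => ?_
    obtain ⟨g, -, rfl⟩ := List.mem_map.1 hx
    exact round_nonneg (Real.exp_pos _).le
  have hneg : ∀ l : List (Vec p s d), 0 ≤ (l.map (L.weight h none)).sum ↔
      (l.map fun g => (round p s (Real.exp (∑ c, (L.WQ h c : ℝ) * (L.WK g c : ℝ))) : ℝ)).sum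
        = 0 := by
    intro l
    have := sum_map_mul_sub l (fun _ => (0 : ℝ))
      (fun g => (round p s (Real.exp (∑ c, (L.WQ h c : ℝ) * (L.WK g c : ℝ))) : ℝ)) 0 1
    simp only [zero_sub, one_mul, mul_zero] at this
    change 0 ≤ (l.map fun g =>
      -(round p s (Real.exp (∑ c, (L.WQ h c : ℝ) * (L.WK g c : ℝ))) : ℝ)).sum ↔ _
    rw [this]
    exact ⟨fun h0 => le_antisymm (by linarith) (hden l), fun h0 => by simp [h0]⟩
  have hthr : ∀ {N D : ℝ} (m : ℤ), 0 < D →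
      ((m : ℝ) ≤ N / D * 2 ^ s ↔ 0 ≤ N * 2 ^ s - m * D) := by
    intro N D m hD
    rw [sub_nonneg, div_mul_eq_mul_div, le_div_iff₀ hD]
  have hlen : ∀ l : List (Vec p s d), l ≠ [] → (0 : ℝ) < l.length := fun l hl => by
    exact_mod_cast List.length_pos_iff.2 hl
  have hone : ∀ l : List (Vec p s d), (l.map fun _ => (1 : ℝ)).sum = l.length := fun l => by simp
  have H0 := H none
  rw [hneg, hneg] at H0
  unfold attend
  by_cases hz : (hs.map fun g =>
      (round p s (Real.exp (∑ c, (L.WQ h c : ℝ) * (L.WK g c : ℝ))) : ℝ)).sum = 0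
  · rw [if_pos hz, if_pos (H0.1 hz)]
    refine round_eq_of_thresholds fun m hm => ?_
    rw [hthr m (hlen _ hne), hthr m (hlen _ hne'), ← hone, ← hone, ← sum_map_mul_sub,
      ← sum_map_mul_sub]
    simp only [mul_one]
    exact H (some (false, c, ⟨m, hm⟩))
  · have hz' := mt H0.2 hz
    rw [if_neg hz, if_neg hz']
    refine round_eq_of_thresholds fun m hm => ?_
    rw [hthr m (lt_of_le_of_ne (hden _) (Ne.symm hz)),
      hthr m (lt_of_le_of_ne (hden _) (Ne.symm hz')), ← sum_map_mul_sub, ← sum_map_mul_sub]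
    exact H (some (true, c, ⟨m, hm⟩))

/-! ### Squares on which affine inequalities do not change -/

/-- Test the centre of the square of side `2 * M`. If the inequality holds there, it holds on the
quadrant in which both terms grow; otherwise it fails on the opposite quadrant. -/
theorem exists_half_square (M : ℕ) (α β γ : ℝ) (x₀ y₀ : ℕ) :
    ∃ x₁ y₁, x₀ ≤ x₁ ∧ y₀ ≤ y₁ ∧ x₁ + M ≤ x₀ + 2 * M ∧ y₁ + M ≤ y₀ + 2 * M ∧
      ∃ q : Prop, ∀ x y : ℕ, x ∈ Set.Icc x₁ (x₁ + M) → y ∈ Set.Icc y₁ (y₁ + M) →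
        (0 ≤ α * x + β * y + γ ↔ q) := by
  have key : ∀ i j : Bool, (0 ≤ α ↔ i = true) → (0 ≤ β ↔ j = true) →
      ∃ x₁ y₁, x₀ ≤ x₁ ∧ y₀ ≤ y₁ ∧ x₁ + M ≤ x₀ + 2 * M ∧ y₁ + M ≤ y₀ + 2 * M ∧
      ∃ q : Prop, ∀ x y : ℕ, x ∈ Set.Icc x₁ (x₁ + M) → y ∈ Set.Icc y₁ (y₁ + M) →
        (0 ≤ α * x + β * y + γ ↔ q) := by
    intro i j hi hj
    by_cases h : 0 ≤ α * (x₀ + M : ℕ) + β * (y₀ + M : ℕ) + γ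
    · refine ⟨if i then x₀ + M else x₀, if j then y₀ + M else y₀, by split_ifs <;> omega,
        by split_ifs <;> omega, by split_ifs <;> omega, by split_ifs <;> omega, True, ?_⟩
      rintro x y ⟨hx1, hx2⟩ ⟨hy1, hy2⟩
      refine iff_true_intro (h.trans ?_)
      gcongr ?_ + ?_ + _
      · cases i
        · exact mul_le_mul_of_nonpos_left (by exact_mod_cast hx2) (by simp at hi; exact hi.le)
        · exact mul_le_mul_of_nonneg_left (by exact_mod_cast hx1) (by simpa using hi)
      · cases j
        · exact mul_le_mul_of_nonpos_left (by exact_mod_cast hy2) (by simp at hj; exact hj.le)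
        · exact mul_le_mul_of_nonneg_left (by exact_mod_cast hy1) (by simpa using hj)
    · refine ⟨if i then x₀ else x₀ + M, if j then y₀ else y₀ + M, by split_ifs <;> omega,
        by split_ifs <;> omega, by split_ifs <;> omega, by split_ifs <;> omega, False, ?_⟩
      rintro x y ⟨hx1, hx2⟩ ⟨hy1, hy2⟩
      refine iff_false_intro fun h' => h (h'.trans ?_)
      gcongr ?_ + ?_ + _
      · cases i
        · exact mul_le_mul_of_nonpos_left (by exact_mod_cast hx1) (by simp at hi; exact hi.le)
        · exact mul_le_mul_of_nonneg_left (by exact_mod_cast hx2) (by simpa using hi)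
      · cases j
        · exact mul_le_mul_of_nonpos_left (by exact_mod_cast hy1) (by simp at hj; exact hj.le)
        · exact mul_le_mul_of_nonneg_left (by exact_mod_cast hy2) (by simpa using hj)
  classical
  exact key (decide (0 ≤ α)) (decide (0 ≤ β)) (by simp) (by simp)

/-- One halving per inequality. `N` does not depend on the coefficients, which matters because they
come from a prefix that is chosen after `N`. -/
theorem exists_subsquare {ι : Type} (t : Finset ι) (M : ℕ) :
    ∃ N, ∀ (α β γ : ι → ℝ) (x₀ y₀ : ℕ),
      ∃ x₁ y₁, x₀ ≤ x₁ ∧ y₀ ≤ y₁ ∧ x₁ + M ≤ x₀ + N ∧ y₁ + M ≤ y₀ + N ∧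
        ∀ i ∈ t, ∃ q : Prop, ∀ x y : ℕ, x ∈ Set.Icc x₁ (x₁ + M) → y ∈ Set.Icc y₁ (y₁ + M) →
          (0 ≤ α i * x + β i * y + γ i ↔ q) := by
  classical
  induction t using Finset.induction_on with
  | empty => exact ⟨M, fun α β γ x₀ y₀ => ⟨x₀, y₀, le_rfl, le_rfl, le_rfl, le_rfl, by simp⟩⟩
  | insert i t _ ih =>
    obtain ⟨N, hN⟩ := ih
    have hMN : M ≤ N := by
      obtain ⟨x, y, h⟩ := hN 0 0 0 0 0
      omega
    refine ⟨2 * N, fun α β γ x₀ y₀ => ?_⟩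
    obtain ⟨x₁, y₁, hx1, hy1, hx2, hy2, q, hq⟩ := exists_half_square N (α i) (β i) (γ i) x₀ y₀
    obtain ⟨x₂, y₂, hx3, hy3, hx4, hy4, h⟩ := hN α β γ x₁ y₁
    refine ⟨x₂, y₂, by omega, by omega, by omega, by omega, fun j hj => ?_⟩
    rcases Finset.mem_insert.1 hj with rfl | hj
    · refine ⟨q, fun x y hx hy => hq x y ?_ ?_⟩
      · exact ⟨hx3.trans hx.1, hx.2.trans hx4⟩
      · exact ⟨hy3.trans hy.1, hy.2.trans hy4⟩
    · exact h j hj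

/-! ### Depth `k` does not recognize `altPlus (k + 1)` -/

/-- The source of affinity: activations that depend only on the letter enter sums through the letter
counts alone. -/
theorem sum_map_eq_count {α : Type} (F : α → ℝ) (r : Letter → α) (v : List Letter) :
    ((v.map r).map F).sum = F (r .a) * v.count .a + F (r .b) * v.count .b := by
  induction v with
  | nil => simp
  | cons z v ih => cases z <;> simp only [List.map_cons, List.sum_cons, ih] <;> simp <;> ring

theorem append_replicate_mem_altPlus {k : ℕ} {u : List Letter} (hu : u ∈ altPlus (k + 1))
    (n : ℕ) : u ++ List.replicate n (blockLetter k) ∈ altPlus (k + 1) := by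
  induction n with
  | zero => simpa using hu
  | succ n ih =>
    rw [List.replicate_succ', ← List.append_assoc, concat_mem_altPlus_succ]
    exact ⟨rfl, .inl ih⟩

/-- Prescribing both letter counts costs only one new block, which is why each layer costs one
block. -/
theorem append_replicate_append_replicate_mem_altPlus {k : ℕ} {u : List Letter}
    (hu : u ∈ altPlus (k + 1)) (m : ℕ) {n : ℕ} (hn : 0 < n) :
    u ++ (List.replicate m (blockLetter k) ++ List.replicate n (blockLetter (k + 1))) ∈
      altPlus (k + 2) := by
  obtain ⟨n, rfl⟩ := Nat.exists_eq_add_one.2 hn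
  rw [List.replicate_succ, ← List.append_assoc, List.append_cons]
  exact append_replicate_mem_altPlus ((concat_mem_altPlus_succ _ _ _).2
    ⟨rfl, .inr (append_replicate_mem_altPlus hu m)⟩) n

/-- Two successive runs can have any positive numbers of occurrences of the two letters. -/
theorem exists_blocks (k x y : ℕ) (hx : 0 < x) (hy : 0 < y) :
    ∃ m n, 0 < n ∧
      (List.replicate m (blockLetter k) ++ List.replicate n (blockLetter (k + 1))).count .a = x ∧
      (List.replicate m (blockLetter k) ++ List.replicate n (blockLetter (k + 1))).count .b = y := by
  have h := blockLetter_succ_ne k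
  cases hk : blockLetter k <;> cases hk' : blockLetter (k + 1)
  · exact absurd (hk'.trans hk.symm) h
  · exact ⟨x, y, hy, by simp [List.count_replicate], by simp [List.count_replicate]⟩
  · exact ⟨y, x, hx, by simp [List.count_replicate], by simp [List.count_replicate]⟩
  · exact absurd (hk'.trans hk.symm) h

/-- After some string with `Ls.length + 1` blocks, the activations on all continuations with at
most `M` occurrences of each letter depend only on the letter. -/
theorem exists_uniform_prefix (pre : List (Vec p s d)) (e : Letter → Vec p s d)
    (Ls : List (Layer p s d)) (M : ℕ) :
    ∃ u ∈ altPlus (Ls.length + 1), ∃ r : Letter → Vec p s d, ∀ v : List Letter,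
      v.count .a ≤ M → v.count .b ≤ M →
        runLayers Ls (pre ++ (u ++ v).map e) = runLayers Ls (pre ++ u.map e) ++ v.map r := by
  induction Ls using List.reverseRecOn generalizing M with
  | nil =>
    refine ⟨[] ++ [.a], (concat_mem_altPlus_succ 0 [] .a).2 ⟨rfl, .inr ?_⟩, e, ?_⟩
    · rw [altPlus_zero]; rfl
    · intro v _ _
      simp [runLayers]
  | append_singleton Ls L ih =>
    -- Side `M + 1` keeps a single letter inside the square even for `M = 0`; it serves below as the
    -- reference continuation.
    obtain ⟨N, hN⟩ := exists_subsquare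
      (({.a, .b} : Finset Letter) ×ˢ (Finset.univ : Finset (ThresholdIndex p d))) (M + 1)
    -- The large square starts at `(1, 1)`, so that both counts are positive as `exists_blocks`
    -- requires; hence counts up to `N + 1` must be controlled.
    obtain ⟨u, hu, r, hr⟩ := ih (N + 1)
    set H := runLayers Ls (pre ++ u.map e)
    obtain ⟨x, y, hx, hy, hxN, hyN, hq⟩ := hN
      (fun i => L.weight (r i.1) i.2 (r .a)) (fun i => L.weight (r i.1) i.2 (r .b))
      (fun i => (H.map (L.weight (r i.1) i.2)).sum) 1 1
    have hq' : ∀ i : Letter × ThresholdIndex p d, ∃ q : Prop, ∀ x' y' : ℕ,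
        x' ∈ Set.Icc x (x + (M + 1)) → y' ∈ Set.Icc y (y + (M + 1)) →
        (0 ≤ L.weight (r i.1) i.2 (r .a) * x' + L.weight (r i.1) i.2 (r .b) * y' +
          (H.map (L.weight (r i.1) i.2)).sum ↔ q) :=
      fun i => hq i (by obtain ⟨z, i⟩ := i; cases z <;> simp)
    choose q hq using hq'
    obtain ⟨m, n, hn, hwa, hwb⟩ := exists_blocks Ls.length x y hx hy
    set w := List.replicate m (blockLetter Ls.length) ++
      List.replicate n (blockLetter (Ls.length + 1))
    have hsign : ∀ v : List Letter, v.count .a ≤ M + 1 → v.count .b ≤ M + 1 → ∀ z i,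
        (0 ≤ ((H ++ (w ++ v).map r).map (L.weight (r z) i)).sum ↔ q (z, i)) := by
      intro v ha hb z i
      rw [← hq (z, i) ((w ++ v).count .a) ((w ++ v).count .b)
        (by rw [List.count_append, hwa]; constructor <;> omega)
        (by rw [List.count_append, hwb]; constructor <;> omega),
        List.map_append, List.sum_append, sum_map_eq_count, add_comm]
    -- The new activation of `z` is the one it gets directly after `w`; the constant signs give the
    -- same value at later occurrences in the square.
    refine ⟨u ++ w, ?_, fun z => L.next (H ++ (w ++ [z]).map r) (r z), fun v => ?_⟩
    · simpa using append_replicate_append_replicate_mem_altPlus hu m hn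
    · induction v using List.reverseRecOn with
      | nil => simp
      | append_singleton v z ihv =>
        intro ha hb
        have ha' : v.count .a ≤ M := le_trans (by simp) ha
        have hb' : v.count .b ≤ M := le_trans (by simp) hb
        have hz : ∀ c, [z].count c ≤ 1 := fun c => List.count_le_length
        have h1 := hr (w ++ v) (by rw [List.count_append, hwa]; omega)
          (by rw [List.count_append, hwb]; omega)
        have h2 := hr (w ++ (v ++ [z])) (by rw [List.count_append, hwa]; omega)
          (by rw [List.count_append, hwb]; omega)
        have h3 : H ++ (w ++ (v ++ [z])).map r = (H ++ (w ++ v).map r) ++ [r z] := by simp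
        have ih' := ihv ha' hb'
        rw [runLayers_concat, List.append_assoc u w v, h1] at ih'
        have h4 : L.next (H ++ (w ++ (v ++ [z])).map r) (r z) =
            L.next (H ++ (w ++ [z]).map r) (r z) := by
          refine L.next_eq_of_thresholds (r z) (by simp) (by simp) fun i => ?_
          rw [hsign (v ++ [z]) (by omega) (by omega),
            hsign [z] ((hz _).trans (by omega)) ((hz _).trans (by omega))]
        rw [runLayers_concat, List.append_assoc u w, h2, h3, L.scan_concat, ih', ← h3, h4]
        simp

/-- `pre` and `ι` treat both conventions for the beginning of the string at once. Continuations of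
length at most two suffice. -/
theorem not_recognizes_altPlus_succ (T : FPTransformer σ p s d) (pre : List σ) (ι : Letter → σ) :
    ¬ ∀ w : List Letter, T.Accepts (pre ++ w.map ι) ↔ w ∈ altPlus (T.depth + 1) := by
  intro H
  obtain ⟨u, hu, r, hr⟩ := exists_uniform_prefix (pre.map T.embed) (T.embed ∘ ι) T.layers 2
  change u ∈ altPlus (T.depth + 1) at hu
  generalize T.depth = k at H hu
  have hacc : ∀ v z, (v ++ [z]).length ≤ 2 →
      (u ++ (v ++ [z]) ∈ altPlus (k + 1) ↔ 0 < (T.Wout (r z) : ℝ)) := by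
    intro v z hv
    rw [← H, accepts_iff, List.map_append, List.map_map,
      hr _ (List.count_le_length.trans hv) (List.count_le_length.trans hv)]
    simp
  have h1 : u ++ ([] ++ [blockLetter k]) ∈ altPlus (k + 1) :=
    (concat_mem_altPlus_succ _ _ _).2 ⟨rfl, .inl hu⟩
  -- Both continuations end in the same letter, so they get the same verdict, although the longer
  -- one has already opened a block too many.
  have h2 := (hacc [blockLetter (k + 1)] _ (by simp)).2 ((hacc [] _ (by simp)).1 h1)
  have h3 : u ++ [blockLetter (k + 1)] ∈ altPlus (k + 2) :=
    (concat_mem_altPlus_succ _ _ _).2 ⟨rfl, .inr hu⟩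
  have h4 : u ++ [blockLetter (k + 1)] ++ [blockLetter k] ∈ altPlus (k + 1) := by simpa using h2
  rw [mem_altPlus_succ_iff, numBlocks_concat, ((mem_altPlus_succ_iff _ _).1 h3).1] at h4
  split_ifs at h4 <;> omega

/-! ### An additional layer -/

/-- The layer that leaves all activations unchanged. -/
def Layer.idle (p s d : ℕ) : Layer p s d where
  WQ := id
  WK := id
  WV := fun _ _ => ⟨0, zero_mem_fixedPrec⟩
  f := id

theorem Layer.next_idle (hs : List (Vec p s d)) (h : Vec p s d) :
    (Layer.idle p s d).next hs h = h := by
  funext c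
  have : ((Layer.idle p s d).attend hs h c : ℝ) = 0 := by
    simp [attend, idle, round_zero]
  change round p s (((Layer.idle p s d).attend hs h c : ℝ) + (h c : ℝ)) = h c
  rw [this, zero_add, round_coe]

theorem Layer.scan_idle (hs : List (Vec p s d)) : (Layer.idle p s d).scan hs = hs := by
  induction hs using List.reverseRecOn with
  | nil => rfl
  | append_singleton hs h ih => rw [scan_concat, ih, next_idle]

/-- The transformer with an additional idle layer. -/
def addIdle (T : FPTransformer σ p s d) : FPTransformer σ p s d where
  embed := T.embed
  layers := T.layers ++ [Layer.idle p s d]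
  Wout := T.Wout

theorem depth_addIdle (T : FPTransformer σ p s d) : T.addIdle.depth = T.depth + 1 := by
  simp [addIdle, depth]

theorem accepts_addIdle (T : FPTransformer σ p s d) (w : List σ) :
    T.addIdle.Accepts w ↔ T.Accepts w := by
  simp [accepts_iff, addIdle, runLayers_concat, Layer.scan_idle]

/-- The right side says that some nonempty prefix ends in `x` and has at least `m` blocks; on the
left, that prefix is either the whole string or a prefix of `w`. -/
theorem numBlocks_concat_iff (m : ℕ) (hm : 0 < m) (x z : Letter) (w : List Letter) :
    ((z = x ∧ m ≤ numBlocks (w ++ [z])) ∨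
        (m ≤ numBlocks w ∧ w.getLast? = some x) ∨ m + 1 ≤ numBlocks w) ↔
      (m ≤ numBlocks (w ++ [z]) ∧ (w ++ [z]).getLast? = some x) ∨
        m + 1 ≤ numBlocks (w ++ [z]) := by
  rw [numBlocks_concat, List.getLast?_concat, Option.some_inj]
  split_ifs with hz
  · rw [hz, Option.some_inj]
    by_cases hx : z = x <;> simp [hx]
  · rcases w.eq_nil_or_concat with rfl | ⟨w, y, rfl⟩
    · simp; grind
    · simp only [List.concat_eq_append, List.getLast?_concat, Option.some_inj] at hz ⊢
      have hxyz : z = x ∨ y = x := by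
        by_contra! hne
        exact hz (eq_of_ne_of_ne hne.2 hne.1)
      by_cases hx : z = x
      · have : y ≠ x := by rintro rfl; exact hz hx.symm
        simp [hx, this]; omega
      · simp [hx, hxyz.resolve_left hx]; omega

/-! ### Depth `k + 1` recognizes `altPlus (k + 1)` -/

/-- A natural number as a fixed-precision number without fractional bits, `0` if out of range. -/
def natFP (p n : ℕ) : fixedPrec p 0 :=
  if h : n < 2 ^ (p - 1) then
    ⟨n, n, by have : (0 : ℤ) < 2 ^ (p - 1) := by positivity
              omega, by exact_mod_cast h, by simp⟩
  else ⟨0, zero_mem_fixedPrec⟩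

theorem coe_natFP {n : ℕ} (h : n < 2 ^ (p - 1)) : (natFP p n : ℝ) = n := by simp [natFP, h]

/-- The fixed-precision number `-1`. -/
def negOneFP (p : ℕ) : fixedPrec p 0 :=
  ⟨-1, -1, by have : (0 : ℤ) < 2 ^ (p - 1) := by positivity
              omega, by have : (0 : ℤ) < 2 ^ (p - 1) := by positivity
                        omega, by simp⟩

/-- A pair of a letter and a number of blocks as a natural number. -/
def blockCode : Letter → ℕ → ℕ
  | .a, m => 2 * m
  | .b, m => 2 * m + 1

theorem blockCode_inj {x y : Letter} {m n : ℕ} (h : blockCode x m = blockCode y n) :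
    x = y ∧ m = n := by
  cases x <;> cases y <;> simp [blockCode] at h ⊢ <;> omega

/-- The activation that stores a natural number. -/
def codeVec (p n : ℕ) : Vec p 0 3 := ![natFP p n, natFP p 0, natFP p 0]

open Classical in
/-- The layer that replaces the code of `m` blocks by that of `m + 1` blocks at the positions
that see the code of `m` blocks with the other letter. -/
noncomputable def countLayer (p m : ℕ) : Layer p 0 3 where
  WQ := fun _ _ => natFP p 0
  WK := fun _ _ => natFP p 0
  WV := fun h => ![natFP p 0,
    if h = codeVec p (blockCode .a m) then negOneFP p else natFP p 0,
    if h = codeVec p (blockCode .b m) then negOneFP p else natFP p 0]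
  f := fun g =>
    ![if g 0 = natFP p (blockCode .a m) ∧ (g 2 : ℝ) < 0 then natFP p (blockCode .a (m + 1))
      else if g 0 = natFP p (blockCode .b m) ∧ (g 1 : ℝ) < 0 then natFP p (blockCode .b (m + 1))
      else g 0, natFP p 0, natFP p 0]

theorem natFP_inj {m n : ℕ} (hm : m < 2 ^ (p - 1)) (hn : n < 2 ^ (p - 1)) :
    natFP p m = natFP p n ↔ m = n := by
  rw [← Subtype.coe_inj, coe_natFP hm, coe_natFP hn, Nat.cast_inj]

theorem codeVec_inj {m n : ℕ} (hm : m < 2 ^ (p - 1)) (hn : n < 2 ^ (p - 1)) :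
    codeVec p m = codeVec p n ↔ m = n :=
  ⟨fun h => (natFP_inj hm hn).1 (congrFun h 0), fun h => by rw [h]⟩

/-- Rounding goes down, so an average of -1/n stays negative for every n, whereas a small positive
average could be lost. Hence the marks have value -1. -/
theorem round_neg {x : ℝ} (hx : x < 0) : (round p s x : ℝ) < 0 := by
  have h0 : ⌊x * 2 ^ s⌋ < 0 := Int.floor_lt.2 (by
    rw [Int.cast_zero]; exact mul_neg_of_neg_of_pos hx (by positivity))
  have hB : (0 : ℤ) < 2 ^ (p - 1) := by positivity
  change ((max (-2 ^ (p - 1)) (min ⌊x * 2 ^ s⌋ (2 ^ (p - 1) - 1)) : ℤ) : ℝ) / 2 ^ s < 0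
  refine div_neg_of_neg_of_pos ?_ (by positivity)
  exact_mod_cast (by omega : max (-2 ^ (p - 1)) (min ⌊x * 2 ^ s⌋ (2 ^ (p - 1) - 1)) < (0 : ℤ))

theorem sum_map_neg_iff {α : Type} (F : α → ℝ) (hF : ∀ g, F g ≤ 0) (l : List α) :
    (l.map F).sum ≤ 0 ∧ ((l.map F).sum < 0 ↔ ∃ g ∈ l, F g < 0) := by
  induction l with
  | nil => simp
  | cons g l ih =>
    have hg := hF g
    simp only [List.map_cons, List.sum_cons, List.mem_cons, exists_eq_or_imp, ← ih.2]
    refine ⟨by linarith, fun h => ?_, fun h => ?_⟩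
    · by_contra! h'
      linarith
    · rcases h with h | h <;> linarith [ih.1]

theorem attend_countLayer (hp : 2 ≤ p) (m : ℕ) {hs : List (Vec p 0 3)} (hne : hs ≠ [])
    (h : Vec p 0 3) (c : Fin 3) :
    (countLayer p m).attend hs h c =
      round p 0 ((hs.map fun g => ((countLayer p m).WV g c : ℝ)).sum / hs.length) := by
  -- The number 1 must be representable, so that the weight e^0 is rounded to 1 and attention is a
  -- plain average.
  have h2 : 1 < 2 ^ (p - 1) := Nat.one_lt_two_pow (by omega)
  have hexp : ∀ g, Real.exp (∑ c, ((countLayer p m).WQ h c : ℝ) * ((countLayer p m).WK g c : ℝ))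
      = 1 := by
    intro g
    simp [countLayer, coe_natFP]
  have hr : (round p 0 1 : ℝ) = 1 := by
    have := congrArg Subtype.val (round_coe (natFP p 1))
    rwa [coe_natFP h2, Nat.cast_one] at this
  simp only [Layer.attend, hexp, hr, one_mul, round_coe]
  have hlen : (hs.map fun _ => (1 : ℝ)).sum = hs.length := by simp
  rw [hlen, if_neg (by simpa using hne)]

/-- Coordinate 0 has zero values, so the residual connection carries the code through. Coordinates 1
and 2 are empty in a code and become negative exactly when the code of `m` blocks with letter a,
respectively b, is visible. -/
theorem next_countLayer (hp : 2 ≤ p) {m : ℕ} (hm : blockCode .b (m + 1) < 2 ^ (p - 1))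
    {hs : List (Vec p 0 3)} (hne : hs ≠ []) (z : Letter) {j : ℕ} (hj : j ≤ m) :
    (countLayer p m).next hs (codeVec p (blockCode z j)) =
      open Classical in codeVec p (blockCode z
        (if j = m ∧ ∃ x ≠ z, codeVec p (blockCode x m) ∈ hs then m + 1 else j)) := by
  have hcode : ∀ x i, i ≤ m + 1 → blockCode x i < 2 ^ (p - 1) := by
    intro x i hi
    refine lt_of_le_of_lt ?_ hm
    cases x <;> simp only [blockCode] <;> omega
  have h0 : (natFP p 0 : ℝ) = 0 := by simp [coe_natFP]
  have hlen : (0 : ℝ) < hs.length := by exact_mod_cast List.length_pos_iff.2 hne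
  set h := codeVec p (blockCode z j) with hh
  have hneg : ∀ c : Fin 3, (h c : ℝ) = 0 → ((round p 0 (((countLayer p m).attend hs h c : ℝ) +
      (h c : ℝ)) : ℝ) < 0 ↔ ∃ g ∈ hs, ((countLayer p m).WV g c : ℝ) < 0) := by
    intro c hc
    have hle : ∀ g, ((countLayer p m).WV g c : ℝ) ≤ 0 := by
      intro g
      fin_cases c
      · simp [countLayer, h0]
      all_goals
        simp only [countLayer]
        simp
        split_ifs <;> simp [h0, negOneFP]
    obtain ⟨hs0, hs1⟩ := sum_map_neg_iff (fun g => ((countLayer p m).WV g c : ℝ)) hle hs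
    rw [hc, add_zero, round_coe, attend_countLayer hp m hne, ← hs1]
    constructor
    · intro hr
      by_contra! hge
      rw [le_antisymm hs0 hge, zero_div, round_zero] at hr
      exact lt_irrefl _ hr
    · intro hlt
      exact round_neg (div_neg_of_neg_of_pos hlt hlen)
  have hc0 : round p 0 (((countLayer p m).attend hs h 0 : ℝ) + (h 0 : ℝ)) =
      natFP p (blockCode z j) := by
    have : (((countLayer p m).attend hs h 0 : ℝ)) = 0 := by
      rw [attend_countLayer hp m hne]
      simp [countLayer, h0, round_zero]
    rw [this, zero_add, round_coe]
    rfl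
  have hmem : ∀ n, (∃ g ∈ hs, ((if g = codeVec p n then negOneFP p else natFP p 0 :
      fixedPrec p 0) : ℝ) < 0) ↔ codeVec p n ∈ hs := by
    intro n
    constructor
    · rintro ⟨g, hg, hlt⟩
      split_ifs at hlt with h'
      · rwa [← h']
      · simp [h0] at hlt
    · intro hn
      exact ⟨_, hn, by simp [negOneFP]⟩
  have hc1 := hneg 1 h0
  have hc2 := hneg 2 h0
  have hinj : ∀ x, natFP p (blockCode z j) = natFP p (blockCode x m) ↔ z = x ∧ j = m := by
    intro x
    rw [natFP_inj (hcode _ _ (by omega)) (hcode _ _ (by omega))]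
    exact ⟨blockCode_inj, by rintro ⟨rfl, rfl⟩; rfl⟩
  have hV1 : ∀ g, (countLayer p m).WV g 1 =
    if g = codeVec p (blockCode .a m) then negOneFP p else natFP p 0 := fun _ => rfl
  have hV2 : ∀ g, (countLayer p m).WV g 2 =
    if g = codeVec p (blockCode .b m) then negOneFP p else natFP p 0 := fun _ => rfl
  simp only [hV1, hV2, hmem] at hc1 hc2
  have hcodeVec : ∀ n, codeVec p n = ![natFP p n, natFP p 0, natFP p 0] := fun _ => rfl
  have hex : (∃ x ≠ z, codeVec p (blockCode x m) ∈ hs) ↔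
      (z = .a ∧ codeVec p (blockCode .b m) ∈ hs) ∨ (z = .b ∧ codeVec p (blockCode .a m) ∈ hs) := by
    constructor
    · rintro ⟨x, hx, hmx⟩
      cases x <;> cases z <;> simp_all
    · rintro (⟨rfl, hx⟩ | ⟨rfl, hx⟩)
      · exact ⟨.b, by simp, hx⟩
      · exact ⟨.a, by simp, hx⟩
  change ![_, natFP p 0, natFP p 0] = _
  rw [hcodeVec]
  congr 1
  simp only [hc0, hc1, hc2, hinj, hex]
  cases z <;> simp <;> split_ifs <;> simp_all

/-- The code of a position after `l` layers that count blocks is determined by the minimum of the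
number of blocks and `l + 1`. -/
theorem runLayers_countLayer (hp : 2 ≤ p) (q : List (Vec p 0 3)) (hq : ∀ h ∈ q, h = codeVec p 0)
    (l : ℕ) (hl : blockCode .b (l + 1) < 2 ^ (p - 1)) :
    runLayers ((List.range l).map fun i => countLayer p (i + 1)) q = q ∧
      ∀ (w : List Letter) (z : Letter),
        runLayers ((List.range l).map fun i => countLayer p (i + 1))
            (q ++ (w ++ [z]).map fun z => codeVec p (blockCode z 1)) =
          runLayers ((List.range l).map fun i => countLayer p (i + 1))
            (q ++ w.map fun z => codeVec p (blockCode z 1)) ++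
            [codeVec p (blockCode z (min (numBlocks (w ++ [z])) (l + 1)))] := by
  induction l with
  | zero =>
    refine ⟨rfl, fun w z => ?_⟩
    have := numBlocks_pos (w := w ++ [z]) (by simp)
    rw [min_eq_right (by omega)]
    simp [runLayers]
  | succ l ih =>
    have hcode : ∀ x i, i ≤ l + 2 → blockCode x i < 2 ^ (p - 1) := by
      intro x i hi
      refine lt_of_le_of_lt ?_ hl
      cases x <;> simp only [blockCode] <;> omega
    replace ih := ih (hcode _ _ (by omega))
    obtain ⟨ih0, ih⟩ := ih
    rw [List.range_succ, List.map_append, List.map_singleton]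
    simp only [runLayers_concat]
    generalize runLayers ((List.range l).map fun i => countLayer p (i + 1)) = R at ih0 ih ⊢
    have hmem : ∀ x w, codeVec p (blockCode x (l + 1)) ∈
        R (q ++ w.map fun z => codeVec p (blockCode z 1)) ↔
        (l + 1 ≤ numBlocks w ∧ w.getLast? = some x) ∨ l + 1 + 1 ≤ numBlocks w := by
      intro x w
      induction w using List.reverseRecOn with
      | nil =>
        simp only [List.map_nil, List.append_nil, ih0, numBlocks_nil]
        have : codeVec p (blockCode x (l + 1)) ∉ q := by
          intro h
          have := (codeVec_inj (hcode _ _ (by omega)) (by positivity)).1 (hq _ h)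
          cases x <;> simp [blockCode] at this
        simp [this]
      | append_singleton w z ihw =>
        rw [ih, List.mem_append, ihw, List.mem_singleton,
          ← numBlocks_concat_iff (l + 1) (by omega) x z w, or_comm,
          codeVec_inj (hcode _ _ (by omega)) (hcode _ _ (by omega))]
        refine or_congr_left ⟨fun h => ?_, ?_⟩
        · obtain ⟨h1, h2⟩ := blockCode_inj h
          exact ⟨h1.symm, by omega⟩
        · rintro ⟨rfl, h⟩
          rw [min_eq_right h]
    constructor
    · rw [ih0]
      clear ih0 ih hmem
      induction q using List.reverseRecOn with
      | nil => rfl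
      | append_singleton q h ihq =>
        -- The beginning-of-string code 0 reads as zero blocks, a count that no layer increases.
        obtain rfl : h = codeVec p (blockCode .a 0) := hq h (by simp)
        rw [Layer.scan_concat, ihq fun h' hh => hq h' (by simp [hh]),
          next_countLayer hp hl (by simp) _ (by omega)]
        simp
    · intro w z
      rw [ih, Layer.scan_concat, ← ih, next_countLayer hp hl (by rw [ih]; simp) _ (by omega)]
      -- With exactly `l + 1` blocks, only the last letter carries the code of `l + 1` blocks; any
      -- further block makes the other letter carry it too.
      have hex : (∃ x ≠ z, codeVec p (blockCode x (l + 1)) ∈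
          R (q ++ (w ++ [z]).map fun z => codeVec p (blockCode z 1))) ↔
          l + 1 + 1 ≤ numBlocks (w ++ [z]) := by
        constructor
        · rintro ⟨x, hx, h⟩
          rcases (hmem x _).1 h with ⟨-, h⟩ | h
          · rw [List.getLast?_concat, Option.some_inj] at h
            exact absurd h.symm hx
          · exact h
        · intro h
          cases z
          · exact ⟨.b, by simp, (hmem _ _).2 (.inr h)⟩
          · exact ⟨.a, by simp, (hmem _ _).2 (.inr h)⟩
      congr 4
      split_ifs with h <;> rw [hex] at h <;> omega

open Classical in
/-- A transformer that counts blocks of letters. -/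
noncomputable def blockCounter (e : σ → Vec p 0 3) (k : ℕ) : FPTransformer σ p 0 3 where
  embed := e
  layers := (List.range (k + 1)).map fun i => countLayer p (i + 1)
  Wout := fun h => if h = codeVec p (blockCode (blockLetter k) (k + 1)) then natFP p 1
    else natFP p 0

theorem accepts_blockCounter (e : σ → Vec p 0 3) (k : ℕ) (hp : 2 ≤ p)
    (hk : blockCode .b (k + 2) < 2 ^ (p - 1)) (pre : List σ) (ι : Letter → σ)
    (hpre : ∀ x ∈ pre, e x = codeVec p 0) (hι : ∀ z, e (ι z) = codeVec p (blockCode z 1))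
    (w : List Letter) :
    (blockCounter e k).Accepts (pre ++ w.map ι) ↔ w ∈ altPlus (k + 1) := by
  have hcode : ∀ x i, i ≤ k + 2 → blockCode x i < 2 ^ (p - 1) := by
    intro x i hi
    refine lt_of_le_of_lt ?_ hk
    cases x <;> simp only [blockCode] <;> omega
  -- After `k + 1` layers the cap is `k + 2`, just enough to tell exactly `k + 1` blocks from more.
  obtain ⟨h0, h1⟩ := runLayers_countLayer hp (pre.map e) (by simpa using hpre) (k + 1) hk
  have hout : ∀ n, n < 2 ^ (p - 1) → (0 < ((blockCounter e k).Wout (codeVec p n) : ℝ) ↔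
      n = blockCode (blockLetter k) (k + 1)) := by
    intro n hn
    simp only [blockCounter, codeVec_inj hn (hcode (blockLetter k) (k + 1) (by omega))]
    have h2 : 1 < 2 ^ (p - 1) := Nat.one_lt_two_pow (by omega)
    split_ifs with h <;> simp [h, coe_natFP h2, coe_natFP]
  have hmap : (w.map ι).map e = w.map fun z => codeVec p (blockCode z 1) := by
    simp [hι]
  rw [accepts_iff, List.map_append]
  change (∃ h, (runLayers ((List.range (k + 1)).map fun i => countLayer p (i + 1))
    (pre.map e ++ (w.map ι).map e)).getLast? = some h ∧ _) ↔ _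
  rw [hmap]
  rcases w.eq_nil_or_concat with rfl | ⟨w, z, rfl⟩
  · rw [List.map_nil, List.append_nil, h0]
    refine iff_of_false ?_ (nil_notMem_altPlus_succ k)
    rintro ⟨h, hh, hpos⟩
    obtain ⟨x, hx, rfl⟩ := List.mem_map.1 (List.mem_of_getLast? hh)
    rw [hpre x hx, hout 0 (by positivity)] at hpos
    cases hb : blockLetter k <;> simp [hb, blockCode] at hpos
  · rw [List.concat_eq_append, h1, mem_altPlus_succ_iff]
    simp only [List.getLast?_concat, Option.some_inj, exists_eq_left']
    rw [hout _ (hcode _ _ (by omega))]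
    constructor
    · intro h
      obtain ⟨h2, h3⟩ := blockCode_inj h
      exact ⟨by omega, h2⟩
    · rintro ⟨h2, rfl⟩
      rw [h2, min_eq_left (by omega)]

theorem exists_recognizes_altPlus_succ (k : ℕ) (pre : List σ) (ι : Letter → σ)
    (lab : σ → Option Letter) (hpre : ∀ x ∈ pre, lab x = none) (hι : ∀ z, lab (ι z) = some z) :
    ∃ (p s d : ℕ) (T : FPTransformer σ p s d), 1 ≤ p ∧ T.depth = k + 1 ∧
      ∀ w : List Letter, T.Accepts (pre ++ w.map ι) ↔ w ∈ altPlus (k + 1) := by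
  let e : σ → Vec (2 * k + 6) 0 3 := fun x =>
    codeVec (2 * k + 6) ((lab x).elim 0 fun z => blockCode z 1)
  refine ⟨2 * k + 6, 0, 3, blockCounter e k, by omega, by simp [blockCounter, depth],
    accepts_blockCounter e k (by omega) ?_ pre ι ?_ ?_⟩
  -- The largest code in use is `2 * (k + 2) + 1`, which dictates the precision.
  · have : 2 * k + 5 < 2 ^ (2 * k + 5) := Nat.lt_two_pow_self
    change 2 * (k + 2) + 1 < 2 ^ (2 * k + 5)
    omega
  · intro x hx
    simp [e, hpre x hx]
  · intro z
    simp [e, hι]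

/-! ### Strictness of the depth hierarchy -/

theorem ssubset_of_witness {α : Type} {A B : Set α} {x : α} (h : A ⊆ B) (hB : x ∈ B)
    (hA : x ∉ A) : A ⊂ B :=
  ⟨h, fun h' => hA (h' hB)⟩

theorem recognizableBOS_subset_succ (σ : Type) (k : ℕ) :
    recognizableBOS σ k ⊆ recognizableBOS σ (k + 1) := by
  rintro L ⟨p, s, d, T, hp, rfl, hT⟩
  exact ⟨p, s, d, T.addIdle, hp, T.depth_addIdle, fun w => (T.accepts_addIdle _).trans (hT w)⟩

theorem recognizable_subset_succ (σ : Type) (k : ℕ) :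
    recognizable σ k ⊆ recognizable σ (k + 1) := by
  rintro L ⟨p, s, d, T, hp, rfl, hT⟩
  exact ⟨p, s, d, T.addIdle, hp, T.depth_addIdle, fun w => (T.accepts_addIdle _).trans (hT w)⟩

theorem altPlus_succ_mem_recognizableBOS (k : ℕ) :
    altPlus (k + 1) ∈ recognizableBOS Letter (k + 1) :=
  exists_recognizes_altPlus_succ k [none] some id (by simp) fun _ => rfl

theorem altPlus_succ_mem_recognizable (k : ℕ) :
    altPlus (k + 1) ∈ recognizable Letter (k + 1) := by
  obtain ⟨p, s, d, T, hp, hT, h⟩ :=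
    exists_recognizes_altPlus_succ k [] id some (by simp) fun _ => rfl
  exact ⟨p, s, d, T, hp, hT, fun w => by simpa using h w⟩

theorem altPlus_succ_notMem_recognizableBOS (k : ℕ) :
    altPlus (k + 1) ∉ recognizableBOS Letter k := by
  rintro ⟨p, s, d, T, -, rfl, hT⟩
  exact T.not_recognizes_altPlus_succ [none] some hT

theorem altPlus_succ_notMem_recognizable (k : ℕ) :
    altPlus (k + 1) ∉ recognizable Letter k := by
  rintro ⟨p, s, d, T, -, rfl, hT⟩
  exact T.not_recognizes_altPlus_succ [] id fun w => by simpa using hT w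

end FPTransformer

theorem mainTheorem3 (k : ℕ) :
    (FPTransformer.altPlus (k + 1) ∈ FPTransformer.recognizableBOS FPTransformer.Letter (k + 1) ∧
      FPTransformer.altPlus (k + 1) ∉ FPTransformer.recognizableBOS FPTransformer.Letter k ∧
      FPTransformer.recognizableBOS FPTransformer.Letter k ⊂
        FPTransformer.recognizableBOS FPTransformer.Letter (k + 1)) ∧
    (FPTransformer.altPlus (k + 1) ∈ FPTransformer.recognizable FPTransformer.Letter (k + 1) ∧
      FPTransformer.altPlus (k + 1) ∉ FPTransformer.recognizable FPTransformer.Letter k ∧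
      FPTransformer.recognizable FPTransformer.Letter k ⊂
        FPTransformer.recognizable FPTransformer.Letter (k + 1)) :=
  open FPTransformer in
  ⟨⟨altPlus_succ_mem_recognizableBOS k, altPlus_succ_notMem_recognizableBOS k,
      ssubset_of_witness (recognizableBOS_subset_succ _ k) (altPlus_succ_mem_recognizableBOS k)
        (altPlus_succ_notMem_recognizableBOS k)⟩,
    altPlus_succ_mem_recognizable k, altPlus_succ_notMem_recognizable k,
      ssubset_of_witness (recognizable_subset_succ _ k) (altPlus_succ_mem_recognizable k)
        (altPlus_succ_notMem_recognizable k)⟩
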